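/- **Setting.** Let $b>0$, $\gamma>0$, let $\mathcal K$ be a compact subset of the Fréchet space $C^\infty([0,b];\mathbb R)$ (topology of the norms $p_N(W)=\max_{0\le k\le N}\sup_{[0,b]}|W^{(k)}|$) and let $K$ be a compact interval in $(0,+\infty)$. Call $W\in\mathcal K$ admissible if $W>0$ on $[0,b]$ and $V(x)=x^\gamma W(x)$ is increasing (not necessarily strictly) on $(0,b]$. Assume there is $\delta>0$ such that $E-x^\gamma W(x)\ge\delta$ for all admissible $W\in\mathcal K$, all $E\in K$ and all $x\in[0,b]$. For admissible $W\in\mathcal K$, $E\in K$, put $q(x)=E-x^\gamma W(x)$ and, for $x\in(0,b]$, $$S(x)=-\int_x^b\sqrt{q(y)}\,dy,\qquad A_0(x)=q(x)^{-1/4},\qquad A_{k+1}(x)=-\frac i2\,A_0(x)\int_x^b A_k''(y)\,A_0(y)\,dy\quad(k\ge 0),$$ and for $h>0$, $N\in\mathbb N$, $$u^+_{h,N}=e^{\frac ihS}\sum_{k=0}^N h^kA_k,\qquad u^-_{h,N}=\overline{u^+_{h,N}}.$$ For an interval $I\subset(0,b]$ let $\|v\|_{C^1(I)}=\sup_{x\in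 I}\max\{|v(x)|,|h\,v'(x)|\}$ be the semiclassical $C^1$ norm (equal to $0$ if $I$ is empty). **Theorem.** For any $\varepsilon\in(0,1)$ and any $D\in\mathbb R$ there exist $N\in\mathbb N$ and $C>0$ such that, for all admissible $W\in\mathcal K$, all $E\in K$ and all $h\in(0,1]$, there are two solutions $\psi^{+}_{\mathrm{ext}},\psi^{-}_{\mathrm{ext}}\in C^2([0,b];\mathbb C)$ of $$-h^2\psi''+x^\gamma W(x)\,\psi=E\,\psi\quad\text{on }[0,b],$$ linearly independent over $\mathbb C$, with $$\|\psi^{\pm}_{\mathrm{ext}}-u^{\pm}_{h,N}\|_{C^1([h^{1-\varepsilon},b])}\le C\,h^{D}.$$ In particular $N$ and $C$ do not depend on $h$, $W$, $E$. -/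

import Mathlib

open Set MeasureTheory
open scoped ContDiff

noncomputable section

/-- The space `C^∞([0,b]; ℝ)`. A smooth function on `[0,b]` (one-sided derivatives at the
endpoints) is represented by its extension by zero to the real line, so that two elements are
equal exactly when they agree on `[0,b]`. -/
structure SmoothOnIcc (b : ℝ) where
  toFun : ℝ → ℝ
  contDiffOn_toFun : ContDiffOn ℝ ∞ toFun (Icc 0 b)
  eq_zero_of_notMem : ∀ x, x ∉ Icc 0 b → toFun x = 0

instance (b : ℝ) : CoeFun (SmoothOnIcc b) (fun _ => ℝ → ℝ) := ⟨SmoothOnIcc.toFun⟩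

/-- The norm `p_N(f) = max { sup_{x ∈ [0,b]} |f^(k)(x)| : 0 ≤ k ≤ N }`. -/
def smoothNorm (b : ℝ) (N : ℕ) (f : ℝ → ℝ) : ℝ :=
  sSup {r : ℝ | ∃ k : ℕ, k ≤ N ∧ ∃ x ∈ Icc 0 b, r = |iteratedDerivWithin k f (Icc 0 b) x|}

/-- The Fréchet topology of `C^∞([0,b]; ℝ)`: it is generated by the open balls of
all the norms `p_N`. -/
instance (b : ℝ) : TopologicalSpace (SmoothOnIcc b) :=
  TopologicalSpace.generateFrom
    {B : Set (SmoothOnIcc b) | ∃ (f : SmoothOnIcc b) (N : ℕ) (r : ℝ), 0 < r ∧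
      B = {g : SmoothOnIcc b | smoothNorm b N (fun x => g x - f x) < r}}

/-- The potential `V(x) = x^γ W(x)`. -/
def potential (γ : ℝ) (W : ℝ → ℝ) (x : ℝ) : ℝ := x ^ γ * W x

/-- The assumptions on the potential `V(x) = x^γ W(x)`, for `γ > 0` and `W` smooth on `[0,b]`:
`W` is positive on `[0,b]` and `V` is increasing on `(0,b]`. (Smoothness of `V` on `(0,b]`,
continuity on `[0,b]` and `V(0) = 0` hold automatically.) -/
def AdmissiblePotential (γ b : ℝ) (W : ℝ → ℝ) : Prop :=
  (∀ x ∈ Icc 0 b, 0 < W x) ∧ MonotoneOn (potential γ W) (Ioc 0 b)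

/-- The phase `S(x) = - ∫_x^b √q(y) dy`. -/
def wkbPhase (b : ℝ) (q : ℝ → ℝ) (x : ℝ) : ℝ := -∫ y in x..b, √(q y)

/-- The WKB amplitudes on `(0,b]`: `A_0 = q^{-1/4}` and
`A_{k+1}(x) = -(i/2) A_0(x) ∫_x^b A_k''(y) A_0(y) dy`, that is, the solution of the transport
equation `2 S' A_{k+1}' + S'' A_{k+1} = i A_k''` which vanishes at `b`. -/
def wkbAmplitude (b : ℝ) (q : ℝ → ℝ) : ℕ → ℝ → ℂ
  | 0 => fun x => ((q x ^ (-(1 / 4) : ℝ) : ℝ) : ℂ)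
  | k + 1 => fun x =>
      -(Complex.I / 2) * ((q x ^ (-(1 / 4) : ℝ) : ℝ) : ℂ) *
        ∫ y in x..b, iteratedDerivWithin 2 (wkbAmplitude b q k) (Ioc 0 b) y *
          ((q y ^ (-(1 / 4) : ℝ) : ℝ) : ℂ)

/-- The order-`N` WKB quasimode `u⁺_{h,N} = exp(iS/h) ∑_{k=0}^N h^k A_k`. -/
def wkbPlus (b : ℝ) (q : ℝ → ℝ) (h : ℝ) (N : ℕ) (x : ℝ) : ℂ :=
  Complex.exp (Complex.I / (h : ℂ) * (wkbPhase b q x : ℂ)) *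
    ∑ k ∈ Finset.range (N + 1), (h : ℂ) ^ k * wkbAmplitude b q k x

/-- The order-`N` WKB quasimode `u⁻_{h,N}`, the complex conjugate of `u⁺_{h,N}`. -/
def wkbMinus (b : ℝ) (q : ℝ → ℝ) (h : ℝ) (N : ℕ) (x : ℝ) : ℂ :=
  starRingEnd ℂ (wkbPlus b q h N x)

/-- `ψ` is a (classical, complex valued) solution on `[0,b]` of `-h² ψ'' + V ψ = E ψ`. -/
def IsSchrodingerSolution (b h : ℝ) (V : ℝ → ℝ) (E : ℝ) (ψ : ℝ → ℂ) : Prop :=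
  ContDiffOn ℝ 2 ψ (Icc 0 b) ∧
    ∀ x ∈ Icc 0 b,
      -(h : ℂ) ^ 2 * iteratedDerivWithin 2 ψ (Icc 0 b) x + (V x : ℂ) * ψ x = (E : ℂ) * ψ x

/-- The semiclassical `C¹` norm on `[a,b]`, `a > 0`, of a function `v` on `(0,b]`:
the supremum of `|v(x)|` and `|h v'(x)|` over `x ∈ [a,b]`. -/
def semiclassicalC1Norm (a b h : ℝ) (v : ℝ → ℂ) : ENNReal :=
  ⨆ x ∈ Icc a b, max ‖v x‖ₑ ‖(h : ℂ) * derivWithin v (Ioc 0 b) x‖ₑ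

end

/-! The exact solution is the one with (almost) the same Cauchy data at `b` as the quasimode `u`,
and the difference `w` is controlled by an energy estimate run backwards from `b`. Since `q` and
`A_0` have derivatives of order `j` that are `O(x^(-j))`, and the recursion differentiates twice and
integrates once, `A_k^(j) = O(x^(-k-j))` uniformly in `W` and `E` (`SymbolClass.wkbAmplitude`);
compactness of `𝒦` enters only through bounds on the derivatives of `W`. The transport equations
cancel every order but the last, so `u'' = -(q/h²) u + exp(iS/h) h^N A_N''`
(`hasDerivWithinAt_wkbPlusDeriv`). For `x ≥ h^(1-ε)` the remainder is `O(h^(ε(N+2)-2))`, hence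
`O(h^(D-1))` for large `N`. The energy `|w|² + h²|w'|²/q` can be propagated backwards without any
bound on `q'`, because `q' ≤ 0` gives its contribution a favourable sign (`energy_le`). This yields
energy `O(h^(2D))`. The second solution is the complex conjugate. Independence is a Wronskian
condition at `b`, which may fail for the exact WKB data; a change of `ψ'(b)` of size at most `h^D`
restores it. -/

/-! ### Global solvability of `y'' = -Q y` on `[0, b]` -/

/-- Truncation of a real number to `[-R, R]`. -/
def truncate (R x : ℝ) : ℝ := max (-R) (min R x)

lemma abs_truncate_sub_le (R x y : ℝ) : |truncate R x - truncate R y| ≤ |x - y| := by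
  have := (((LipschitzWith.id (α := ℝ)).const_min R).const_max (-R)).dist_le_mul x y
  simpa [truncate, Real.dist_eq] using this

lemma abs_truncate_le {R : ℝ} (hR : 0 ≤ R) (x : ℝ) : |truncate R x| ≤ R := by
  unfold truncate
  rw [abs_le]
  exact ⟨le_max_left _ _, max_le (by linarith) (min_le_left _ _)⟩

lemma truncate_eq_self {R x : ℝ} (h : |x| ≤ R) : truncate R x = x := by
  rw [abs_le] at h
  simp [truncate, h.1, h.2]

lemma abs_truncate_le_abs {R : ℝ} (hR : 0 ≤ R) (x : ℝ) : |truncate R x| ≤ |x| := by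
  have h0 : truncate R 0 = 0 := truncate_eq_self (by simpa using hR)
  simpa [h0] using abs_truncate_sub_le R x 0

/-- Picard–Lindelöf on all of `[0, b]` needs a bounded vector field, so the linear field is
truncated at the a priori Gronwall bound; the solution never exceeds that bound and hence solves the
untruncated system. -/
lemma exists_solution_initial {b : ℝ} (hb : 0 ≤ b) {Q : ℝ → ℝ} (hQ : ContinuousOn Q (Icc 0 b))
    (c d : ℝ) :
    ∃ y z : ℝ → ℝ, y 0 = c ∧ z 0 = d ∧ ∀ t ∈ Icc 0 b,
      HasDerivWithinAt y (z t) (Icc 0 b) t ∧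
      HasDerivWithinAt z (-Q t * y t) (Icc 0 b) t := by
  obtain ⟨K₀, hK₀⟩ := isCompact_Icc.exists_bound_of_continuousOn hQ
  -- The `1` accounts for the equation `y' = z`, the bound `K₀` for `z' = -Q y`.
  set K : ℝ := max 1 K₀ with hKdef
  have hK1 : 1 ≤ K := le_max_left _ _
  have hQK : ∀ t ∈ Icc 0 b, |Q t| ≤ K := fun t ht => (hK₀ t ht).trans (le_max_right _ _)
  set R : ℝ := ‖(c, d)‖ * Real.exp (K * b) with hRdef
  have hR : 0 ≤ R := by positivity
  let f : ℝ → ℝ × ℝ → ℝ × ℝ := fun t v => (truncate R v.2, -Q t * truncate R v.1)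
  have hfnorm : ∀ t ∈ Icc 0 b, ∀ v, ‖f t v‖ ≤ K * ‖v‖ := by
    intro t ht v
    have h1 : |v.1| ≤ ‖v‖ := norm_fst_le v
    have h2 : |v.2| ≤ ‖v‖ := norm_snd_le v
    have hv := norm_nonneg v
    rw [Prod.norm_def]
    refine max_le ?_ ?_
    · calc ‖truncate R v.2‖ ≤ |v.2| := abs_truncate_le_abs hR _
        _ ≤ 1 * ‖v‖ := by simpa using h2
        _ ≤ K * ‖v‖ := by gcongr
    · simp only [f, norm_mul, norm_neg, Real.norm_eq_abs]
      exact mul_le_mul (hQK t ht) ((abs_truncate_le_abs hR _).trans h1) (abs_nonneg _) (by linarith)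
  have hfbound : ∀ t ∈ Icc 0 b, ∀ v, ‖f t v‖ ≤ K * R := by
    intro t ht v
    rw [Prod.norm_def]
    refine max_le ?_ ?_
    · calc ‖truncate R v.2‖ ≤ 1 * R := by simpa using abs_truncate_le hR v.2
        _ ≤ K * R := by gcongr
    · simp only [f, norm_mul, norm_neg, Real.norm_eq_abs]
      exact mul_le_mul (hQK t ht) (abs_truncate_le hR _) (abs_nonneg _) (by linarith)
  have hflip : ∀ t ∈ Icc 0 b, LipschitzWith K.toNNReal (f t) := by
    intro t ht
    refine LipschitzWith.of_dist_le_mul fun v w => ?_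
    have h1 : |v.1 - w.1| ≤ dist v w := (le_max_left _ _ : dist v.1 w.1 ≤ _)
    have h2 : |v.2 - w.2| ≤ dist v w := (le_max_right _ _ : dist v.2 w.2 ≤ _)
    rw [Real.coe_toNNReal _ (by linarith), Prod.dist_eq]
    refine max_le ?_ ?_
    · calc dist (f t v).1 (f t w).1 ≤ |v.2 - w.2| := abs_truncate_sub_le R _ _
        _ ≤ 1 * dist v w := by simpa using h2
        _ ≤ K * dist v w := by gcongr
    · have : dist (f t v).2 (f t w).2 = |Q t| * |truncate R v.1 - truncate R w.1| := by
        simp only [f, Real.dist_eq]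
        rw [← mul_sub, abs_mul, abs_neg]
      rw [this]
      exact mul_le_mul (hQK t ht) ((abs_truncate_sub_le R _ _).trans h1) (abs_nonneg _)
        (by linarith)
  have hPL : IsPicardLindelof f (⟨0, ⟨le_rfl, hb⟩⟩ : Icc (0 : ℝ) b) (c, d)
      (K * R * b).toNNReal 0 (K * R).toNNReal K.toNNReal := by
    have hKR : 0 ≤ K * R := by positivity
    refine ⟨fun t ht => (hflip t ht).lipschitzOnWith, fun v _ => ?_, fun t ht v _ => ?_, ?_⟩
    · exact continuousOn_const.prodMk (hQ.neg.mul continuousOn_const)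
    · rw [Real.coe_toNNReal _ hKR]; exact hfbound t ht v
    · rw [Real.coe_toNNReal _ hKR, Real.coe_toNNReal _ (by positivity)]
      simp [hb]
  obtain ⟨α, hα0, hα⟩ := hPL.exists_eq_forall_mem_Icc_hasDerivWithinAt₀
  have hαnorm : ∀ t ∈ Icc 0 b, ‖α t‖ ≤ R := by
    intro t ht
    have hg := norm_le_gronwallBound_of_norm_deriv_right_le (f := α) (f' := fun t => f t (α t))
      (δ := ‖(c, d)‖) (K := K) (ε := 0) (a := 0) (b := b)
      (fun t ht => (hα t ht).continuousWithinAt)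
      (fun t ht => (hα t (Ico_subset_Icc_self ht)).mono_of_mem_nhdsWithin
        (Icc_mem_nhdsGE_of_mem ht))
      (by rw [← hα0]) (fun t ht => by simpa using hfnorm t (Ico_subset_Icc_self ht) (α t)) t ht
    rw [gronwallBound_ε0, sub_zero] at hg
    refine hg.trans ?_
    rw [hRdef]
    have := ht.2
    gcongr
  refine ⟨fun t => (α t).1, fun t => (α t).2, ?_, ?_, fun t ht => ?_⟩
  · exact congrArg Prod.fst hα0
  · exact congrArg Prod.snd hα0
  · have h1 : truncate R (α t).1 = (α t).1 :=
      truncate_eq_self ((norm_fst_le (α t)).trans (hαnorm t ht))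
    have h2 : truncate R (α t).2 = (α t).2 :=
      truncate_eq_self ((norm_snd_le (α t)).trans (hαnorm t ht))
    have h := hα t ht
    simp only [f, h1, h2] at h
    exact ⟨(hasFDerivAt_fst (𝕜 := ℝ) (p := α t)).comp_hasDerivWithinAt t h,
      (hasFDerivAt_snd (𝕜 := ℝ) (p := α t)).comp_hasDerivWithinAt t h⟩

/-- The reflection `t ↦ b - t` preserves the form of the equation and reverses the sign of the
derivative, whence the initial value `-d`. -/
lemma exists_solution_terminal {b : ℝ} (hb : 0 ≤ b) {Q : ℝ → ℝ} (hQ : ContinuousOn Q (Icc 0 b))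
    (c d : ℝ) :
    ∃ y z : ℝ → ℝ, y b = c ∧ z b = d ∧ ∀ t ∈ Icc 0 b,
      HasDerivWithinAt y (z t) (Icc 0 b) t ∧
      HasDerivWithinAt z (-Q t * y t) (Icc 0 b) t := by
  have hmaps : MapsTo (fun t => b - t) (Icc 0 b) (Icc 0 b) := fun t ht =>
    ⟨by linarith [ht.2], by linarith [ht.1]⟩
  obtain ⟨y, z, hy0, hz0, hyz⟩ := exists_solution_initial hb
    (Q := fun t => Q (b - t)) (hQ.comp (by fun_prop) hmaps) c (-d)
  refine ⟨fun t => y (b - t), fun t => -z (b - t), by simpa using hy0, by simp [hz0],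
    fun t ht => ?_⟩
  obtain ⟨h1, h2⟩ := hyz (b - t) (hmaps ht)
  have hs : HasDerivWithinAt (fun t => b - t) (-1) (Icc 0 b) t := by
    simpa using (hasDerivWithinAt_id t (Icc 0 b)).const_sub b
  have h1' := h1.scomp t hs hmaps
  have h2' := (h2.scomp t hs hmaps).neg
  refine ⟨h1'.congr_deriv (by simp), h2'.congr_deriv (by simp)⟩

/-- Solvability of the terminal value problem for `ψ'' = -Q ψ` on `[0, b]`. -/
lemma exists_complex_solution_terminal {b : ℝ} (hb : 0 ≤ b) {Q : ℝ → ℝ}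
    (hQ : ContinuousOn Q (Icc 0 b)) (c d : ℂ) :
    ∃ y z : ℝ → ℂ, y b = c ∧ z b = d ∧ ∀ t ∈ Icc 0 b,
      HasDerivWithinAt y (z t) (Icc 0 b) t ∧
      HasDerivWithinAt z (-(Q t : ℂ) * y t) (Icc 0 b) t := by
  obtain ⟨y₁, z₁, hy₁, hz₁, h₁⟩ := exists_solution_terminal hb hQ 1 0
  obtain ⟨y₂, z₂, hy₂, hz₂, h₂⟩ := exists_solution_terminal hb hQ 0 1
  refine ⟨fun t => c * (y₁ t : ℂ) + d * (y₂ t : ℂ), fun t => c * (z₁ t : ℂ) + d * (z₂ t : ℂ),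
    by simp [hy₁, hy₂], by simp [hz₁, hz₂], fun t ht => ⟨?_, ?_⟩⟩
  · exact ((h₁ t ht).1.ofReal_comp.const_mul c).add ((h₂ t ht).1.ofReal_comp.const_mul d)
  · refine (((h₁ t ht).2.ofReal_comp.const_mul c).add
      ((h₂ t ht).2.ofReal_comp.const_mul d)).congr_deriv ?_
    push_cast; ring

/-! ### Calculus of symbols singular at `0` -/

section Symbols

variable {P F : Type*} [NormedAddCommGroup F] [NormedSpace ℝ F]

/-- `SymbolClass b n m f`: the functions `f p` of the family `f` are `n` times differentiable on
`(0, b]`, and their derivatives of order `k ≤ n` are `O(x^(-m-k))`, uniformly in `p`. -/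
def SymbolClass (b : ℝ) : ℕ → ℕ → (P → ℝ → F) → Prop
  | 0, m, f => (∀ p, ContinuousOn (f p) (Ioc 0 b)) ∧
      ∃ C : ℝ, ∀ p, ∀ x ∈ Ioc 0 b, ‖f p x‖ ≤ C * x⁻¹ ^ m
  | n + 1, m, f => (∃ C : ℝ, ∀ p, ∀ x ∈ Ioc 0 b, ‖f p x‖ ≤ C * x⁻¹ ^ m) ∧
      ∃ f' : P → ℝ → F, (∀ p, ∀ x ∈ Ioc 0 b, HasDerivWithinAt (f p) (f' p x) (Ioc 0 b) x) ∧
        SymbolClass b n (m + 1) f'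

namespace SymbolClass

variable {b : ℝ} {n m : ℕ} {f g : P → ℝ → F}

lemma exists_bound (hf : SymbolClass b n m f) :
    ∃ C : ℝ, ∀ p, ∀ x ∈ Ioc 0 b, ‖f p x‖ ≤ C * x⁻¹ ^ m := by
  cases n with
  | zero => exact hf.2
  | succ n => exact hf.1

lemma continuousOn (hf : SymbolClass b n m f) (p : P) : ContinuousOn (f p) (Ioc 0 b) := by
  cases n with
  | zero => exact hf.1 p
  | succ n =>
    obtain ⟨-, f', hf', -⟩ := hf
    exact fun x hx => (hf' p x hx).continuousWithinAt

lemma of_succ (hf : SymbolClass b (n + 1) m f) : SymbolClass b n m f := by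
  induction n generalizing m f with
  | zero => exact ⟨hf.continuousOn, hf.exists_bound⟩
  | succ n ih =>
    obtain ⟨h1, f', hf', h2⟩ := hf
    exact ⟨h1, f', hf', ih h2⟩

lemma congr (hf : SymbolClass b n m f) (h : ∀ p, EqOn (g p) (f p) (Ioc 0 b)) :
    SymbolClass b n m g := by
  cases n with
  | zero =>
    refine ⟨fun p => (hf.1 p).congr (h p), ?_⟩
    obtain ⟨C, hC⟩ := hf.2
    exact ⟨C, fun p x hx => by rw [h p hx]; exact hC p x hx⟩
  | succ n =>
    obtain ⟨⟨C, hC⟩, f', hf', h2⟩ := hf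
    exact ⟨⟨C, fun p x hx => by rw [h p hx]; exact hC p x hx⟩, f',
      fun p x hx => (hf' p x hx).congr (h p) (h p hx), h2⟩

lemma derivWithin (hf : SymbolClass b (n + 1) m f) :
    SymbolClass b n (m + 1) (fun p => derivWithin (f p) (Ioc 0 b)) := by
  obtain ⟨-, f', hf', h2⟩ := hf
  exact h2.congr fun p x hx => (hf' p x hx).derivWithin (uniqueDiffOn_Ioc 0 b x hx)

lemma hasDerivWithinAt (hf : SymbolClass b (n + 1) m f) (p : P) {x : ℝ} (hx : x ∈ Ioc 0 b) :
    HasDerivWithinAt (f p) (_root_.derivWithin (f p) (Ioc 0 b) x) (Ioc 0 b) x := by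
  obtain ⟨-, f', hf', -⟩ := hf
  exact (hf' p x hx).differentiableWithinAt.hasDerivWithinAt

lemma exists_bound_add (hf : SymbolClass b n m f) (hg : SymbolClass b n m g) :
    ∃ C : ℝ, ∀ p, ∀ x ∈ Ioc 0 b, ‖f p x + g p x‖ ≤ C * x⁻¹ ^ m := by
  obtain ⟨C, hC⟩ := hf.exists_bound
  obtain ⟨C', hC'⟩ := hg.exists_bound
  refine ⟨C + C', fun p x hx => (norm_add_le _ _).trans ?_⟩
  rw [add_mul]
  exact add_le_add (hC p x hx) (hC' p x hx)

lemma add (hf : SymbolClass b n m f) (hg : SymbolClass b n m g) :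
    SymbolClass b n m (fun p x => f p x + g p x) := by
  induction n generalizing m f g with
  | zero => exact ⟨fun p => (hf.1 p).add (hg.1 p), hf.exists_bound_add hg⟩
  | succ n ih =>
    have hbound := hf.exists_bound_add hg
    obtain ⟨-, f', hf', h2⟩ := hf
    obtain ⟨-, g', hg', h3⟩ := hg
    exact ⟨hbound, fun p x => f' p x + g' p x, fun p x hx => (hf' p x hx).add (hg' p x hx),
      ih h2 h3⟩

lemma neg (hf : SymbolClass b n m f) : SymbolClass b n m (fun p x => -f p x) := by
  induction n generalizing m f with
  | zero => exact ⟨fun p => (hf.1 p).neg, by simpa only [norm_neg] using hf.2⟩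
  | succ n ih =>
    obtain ⟨h1, f', hf', h2⟩ := hf
    exact ⟨by simpa only [norm_neg] using h1, fun p x => -f' p x,
      fun p x hx => (hf' p x hx).neg, ih h2⟩

/-- A factor `x ≤ b` is absorbed into the constant. -/
lemma mono_order (hf : SymbolClass b n m f) : SymbolClass b n (m + 1) f := by
  have key : ∀ {m : ℕ} {f : P → ℝ → F}, (∃ C : ℝ, ∀ p, ∀ x ∈ Ioc 0 b, ‖f p x‖ ≤ C * x⁻¹ ^ m) →
      ∃ C : ℝ, ∀ p, ∀ x ∈ Ioc 0 b, ‖f p x‖ ≤ C * x⁻¹ ^ (m + 1) := by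
    rintro m f ⟨C, hC⟩
    refine ⟨C * b, fun p x hx => (hC p x hx).trans ?_⟩
    have hx0 : 0 < x := hx.1
    have hC0 : 0 ≤ C := by
      have := (norm_nonneg _).trans (hC p x hx)
      exact nonneg_of_mul_nonneg_left this (by positivity)
    calc C * x⁻¹ ^ m = C * (x * x⁻¹ ^ (m + 1)) := by rw [pow_succ]; field_simp
      _ ≤ C * (b * x⁻¹ ^ (m + 1)) := by
          have := hx.2
          gcongr
      _ = C * b * x⁻¹ ^ (m + 1) := by ring
  induction n generalizing m f with
  | zero => exact ⟨hf.1, key hf.2⟩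
  | succ n ih =>
    obtain ⟨h1, f', hf', h2⟩ := hf
    exact ⟨key h1, f', hf', ih h2⟩

lemma exists_bound_mul {A : Type*} [NormedRing A] [NormedAlgebra ℝ A] {m' : ℕ} {f g : P → ℝ → A}
    (hf : SymbolClass b n m f) (hg : SymbolClass b n m' g) :
    ∃ C : ℝ, ∀ p, ∀ x ∈ Ioc 0 b, ‖f p x * g p x‖ ≤ C * x⁻¹ ^ (m + m') := by
  obtain ⟨C, hC⟩ := hf.exists_bound
  obtain ⟨C', hC'⟩ := hg.exists_bound
  refine ⟨C * C', fun p x hx => (norm_mul_le _ _).trans ?_⟩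
  calc ‖f p x‖ * ‖g p x‖ ≤ (C * x⁻¹ ^ m) * (C' * x⁻¹ ^ m') :=
        mul_le_mul (hC p x hx) (hC' p x hx) (norm_nonneg _) ((norm_nonneg _).trans (hC p x hx))
    _ = C * C' * x⁻¹ ^ (m + m') := by ring

lemma mul {A : Type*} [NormedRing A] [NormedAlgebra ℝ A] {m' : ℕ} {f g : P → ℝ → A}
    (hf : SymbolClass b n m f) (hg : SymbolClass b n m' g) :
    SymbolClass b n (m + m') (fun p x => f p x * g p x) := by
  induction n generalizing m m' f g with
  | zero => exact ⟨fun p => (hf.1 p).mul (hg.1 p), hf.exists_bound_mul hg⟩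
  | succ n ih =>
    have hbound := hf.exists_bound_mul hg
    have hf₀ := hf.of_succ
    have hg₀ := hg.of_succ
    obtain ⟨-, f', hf', h2⟩ := hf
    obtain ⟨-, g', hg', h3⟩ := hg
    have h4 := ih h2 hg₀
    have h5 := ih hf₀ h3
    refine ⟨hbound, fun p x => f' p x * g p x + f p x * g' p x,
      fun p x hx => (hf' p x hx).mul (hg' p x hx), ?_⟩
    rw [show m + m' + 1 = m + 1 + m' by ring]
    rw [show m + (m' + 1) = m + 1 + m' by ring] at h5
    exact h4.add h5

lemma const (b : ℝ) (n : ℕ) {c : P → F} {C : ℝ} (hc : ∀ p, ‖c p‖ ≤ C) :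
    SymbolClass b n 0 (fun p _ => c p) := by
  induction n generalizing c C with
  | zero => exact ⟨fun p => continuousOn_const, C, fun p x _ => by simpa using hc p⟩
  | succ n ih =>
    exact ⟨⟨C, fun p x _ => by simpa using hc p⟩, fun _ _ => 0,
      fun p x _ => hasDerivWithinAt_const x _ _, (ih (c := fun _ => 0) (C := 0) (by simp)).mono_order⟩

lemma ofReal {f : P → ℝ → ℝ} (hf : SymbolClass b n m f) :
    SymbolClass b n m (fun p x => (f p x : ℂ)) := by
  induction n generalizing m f with
  | zero =>
    exact ⟨fun p => Complex.continuous_ofReal.comp_continuousOn (hf.1 p),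
      by simpa only [Complex.norm_real] using hf.2⟩
  | succ n ih =>
    obtain ⟨h1, f', hf', h2⟩ := hf
    exact ⟨by simpa only [Complex.norm_real] using h1, fun p x => (f' p x : ℂ),
      fun p x hx => (hf' p x hx).ofReal_comp, ih h2⟩

/-- Real powers of a family bounded above and bounded away from zero. -/
lemma rpow_const {q : P → ℝ → ℝ} {δ M : ℝ} (hδ : 0 < δ)
    (hq : ∀ p, ∀ x ∈ Ioc 0 b, q p x ∈ Icc δ M) (hsymb : SymbolClass b n 0 q) (s : ℝ) :
    SymbolClass b n 0 (fun p x => q p x ^ s) := by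
  have hbound : ∀ s : ℝ, ∃ C : ℝ, ∀ p, ∀ x ∈ Ioc 0 b, ‖q p x ^ s‖ ≤ C * x⁻¹ ^ 0 := by
    intro s
    have hc : ContinuousOn (fun t : ℝ => t ^ s) (Icc δ M) := fun t ht =>
      (Real.continuousAt_rpow_const t s (Or.inl (hδ.trans_le ht.1).ne')).continuousWithinAt
    obtain ⟨C, hC⟩ := isCompact_Icc.exists_bound_of_continuousOn hc
    exact ⟨C, fun p x hx => by simpa using hC _ (hq p x hx)⟩
  -- The derivative `s q' q^(s-1)` brings in another power, so the induction runs over all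
  -- exponents.
  induction n generalizing s with
  | zero =>
    exact ⟨fun p => (hsymb.1 p).rpow_const fun x hx => Or.inl (hδ.trans_le (hq p x hx).1).ne',
      hbound s⟩
  | succ n ih =>
    have h0 := ih hsymb.of_succ (s - 1)
    obtain ⟨-, q', hq', h2⟩ := hsymb
    have h3 := (h2.mul (const b n (c := fun _ => s) (C := ‖s‖) fun _ => le_rfl)).mul h0
    exact ⟨hbound s, fun p x => q' p x * s * q p x ^ (s - 1),
      fun p x hx => (hq' p x hx).rpow_const (Or.inl (hδ.trans_le (hq p x hx).1).ne'), h3⟩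

lemma id_rpow (b : ℝ) (n m : ℕ) {s : ℝ} (hs : 0 ≤ s + m) :
    SymbolClass b n m (fun (_ : P) x => x ^ s) := by
  have hbound : ∀ (m : ℕ) (s : ℝ), 0 ≤ s + m →
      ∃ C : ℝ, ∀ _ : P, ∀ x ∈ Ioc 0 b, ‖x ^ s‖ ≤ C * x⁻¹ ^ m := by
    intro m s hs
    refine ⟨b ^ (s + m), fun p x hx => ?_⟩
    have hx0 : 0 < x := hx.1
    rw [Real.norm_of_nonneg (by positivity)]
    calc x ^ s = x ^ (s + m) * x⁻¹ ^ m := by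
          rw [Real.rpow_add hx0, Real.rpow_natCast, inv_pow, mul_assoc,
            mul_inv_cancel₀ (by positivity), mul_one]
      _ ≤ b ^ (s + m) * x⁻¹ ^ m := by
          have := hx.2
          gcongr
  induction n generalizing m s with
  | zero =>
    exact ⟨fun p x hx => (Real.continuousAt_rpow_const x s (Or.inl hx.1.ne')).continuousWithinAt,
      hbound m s hs⟩
  | succ n ih =>
    have h0 := ih (m + 1) (s := s - 1) (by push_cast; linarith)
    have h1 := (const (P := P) b n (c := fun _ => s) (C := ‖s‖) fun _ => le_rfl).mul h0
    rw [zero_add] at h1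
    exact ⟨hbound m s hs, fun p x => s * x ^ (s - 1), fun p x hx =>
      (Real.hasDerivAt_rpow_const (Or.inl hx.1.ne')).hasDerivWithinAt, h1⟩

lemma of_iteratedDerivWithin_bound {f : P → ℝ → F} (hb : 0 < b)
    (hf : ∀ p, ContDiffOn ℝ ∞ (f p) (Icc 0 b))
    (hbound : ∀ k, ∃ C : ℝ, ∀ p, ∀ x ∈ Icc 0 b, ‖iteratedDerivWithin k (f p) (Icc 0 b) x‖ ≤ C)
    (n : ℕ) : SymbolClass b n 0 f := by
  -- Bounded derivatives are `O(x^(-m))` for every `m`, so the induction can let `m` and `k` grow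
  -- together.
  have key : ∀ n m k, SymbolClass b n m (fun p => iteratedDerivWithin k (f p) (Icc 0 b)) := by
    intro n
    have hb0 : ∀ m k, ∃ C : ℝ, ∀ p, ∀ x ∈ Ioc 0 b,
        ‖iteratedDerivWithin k (f p) (Icc 0 b) x‖ ≤ C * x⁻¹ ^ m := by
      intro m k
      obtain ⟨C, hC⟩ := hbound k
      refine ⟨C * b ^ m, fun p x hx => (hC p x (Ioc_subset_Icc_self hx)).trans ?_⟩
      have hC0 : 0 ≤ C := (norm_nonneg _).trans (hC p x (Ioc_subset_Icc_self hx))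
      have hx0 : 0 < x := hx.1
      have : 1 ≤ b ^ m * x⁻¹ ^ m := by
        rw [← mul_pow]
        exact one_le_pow₀ (by rw [← div_eq_mul_inv, one_le_div hx0]; exact hx.2)
      rw [mul_assoc]
      exact le_mul_of_one_le_right hC0 this
    have hder : ∀ p k, ∀ x ∈ Icc 0 b, HasDerivWithinAt (iteratedDerivWithin k (f p) (Icc 0 b))
        (iteratedDerivWithin (k + 1) (f p) (Icc 0 b) x) (Icc 0 b) x := by
      intro p k x hx
      rw [iteratedDerivWithin_succ]
      exact ((hf p).differentiableOn_iteratedDerivWithin (by exact_mod_cast ENat.natCast_lt_top k)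
        (uniqueDiffOn_Icc hb) x hx).hasDerivWithinAt
    induction n with
    | zero =>
      intro m k
      exact ⟨fun p x hx => ((hder p k x (Ioc_subset_Icc_self hx)).mono
        Ioc_subset_Icc_self).continuousWithinAt, hb0 m k⟩
    | succ n ih =>
      intro m k
      exact ⟨hb0 m k, _, fun p x hx => (hder p k x (Ioc_subset_Icc_self hx)).mono
        Ioc_subset_Icc_self, ih (m + 1) (k + 1)⟩
  simpa using key n 0 0

lemma hasDerivWithinAt_integral [CompleteSpace F] {g : ℝ → F} (hg : ContinuousOn g (Ioc 0 b))
    {x : ℝ} (hx : x ∈ Ioc 0 b) :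
    HasDerivWithinAt (fun u => ∫ y in u..b, g y) (-g x) (Ioc 0 b) x := by
  -- `g` may be singular at `0`, so the fundamental theorem is applied on `[x/2, b]`, a
  -- neighbourhood of `x` in `(0, b]`.
  have hx2 : x / 2 ∈ Ioc 0 b := ⟨by linarith [hx.1], by linarith [hx.1, hx.2]⟩
  have hmem : x ∈ Icc (x / 2) b := ⟨by linarith [hx.1], hx.2⟩
  have hsub : Icc (x / 2) b ⊆ Ioc 0 b := fun y hy => ⟨hx2.1.trans_le hy.1, hy.2⟩
  have : Fact (x ∈ Icc (x / 2) b) := ⟨hmem⟩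
  have hcont := hg.mono hsub
  have h := intervalIntegral.integral_hasDerivWithinAt_left (f := g) (a := x) (b := b)
    (s := Icc (x / 2) b) (t := Icc (x / 2) b)
    ((hcont.mono (by rw [uIcc_of_le hx.2]; exact Icc_subset_Icc_left hmem.1)).intervalIntegrable)
    (hcont.stronglyMeasurableAtFilter_nhdsWithin measurableSet_Icc x) (hcont x hmem)
  refine h.mono_of_mem_nhdsWithin ?_
  rw [mem_nhdsWithin]
  exact ⟨Ioi (x / 2), isOpen_Ioi, by simpa using hx.1, fun y hy => ⟨le_of_lt hy.1, hy.2.2⟩⟩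

/-- The order drops by exactly one because the exponent is at least `2`: integrating `y^(-m-2)`
produces no logarithm. -/
lemma integral [CompleteSpace F] (hf : SymbolClass b n (m + 2) f) :
    SymbolClass b (n + 1) (m + 1) (fun p x => ∫ y in x..b, f p y) := by
  refine ⟨?_, fun p x => -f p x, fun p x hx => hasDerivWithinAt_integral (hf.continuousOn p) hx, ?_⟩
  · obtain ⟨C, hC⟩ := hf.exists_bound
    refine ⟨C / (m + 1), fun p x hx => ?_⟩
    have hx0 : 0 < x := hx.1
    have hC0 : 0 ≤ C := nonneg_of_mul_nonneg_left ((norm_nonneg _).trans (hC p x hx)) (by positivity)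
    have hnot : (0 : ℝ) ∉ uIcc x b := by rw [uIcc_of_le hx.2]; exact fun h => absurd h.1 (by linarith)
    have hint : ∫ y in x..b, C * y⁻¹ ^ (m + 2) = C * ((x⁻¹ ^ (m + 1) - b⁻¹ ^ (m + 1)) / (m + 1)) := by
      rw [intervalIntegral.integral_const_mul]
      congr 1
      have hd : ∀ y ∈ uIcc x b, HasDerivAt (fun y : ℝ => -(y⁻¹ ^ (m + 1)) / (m + 1))
          (y⁻¹ ^ (m + 2)) y := by
        intro y hy
        have hy0 : y ≠ 0 := fun h => hnot (h ▸ hy)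
        have := (((hasDerivAt_inv hy0).pow (m + 1)).neg).div_const ((m : ℝ) + 1)
        refine this.congr_deriv ?_
        have : (m : ℝ) + 1 ≠ 0 := by positivity
        rw [Nat.add_sub_cancel, ← inv_pow]
        push_cast
        field_simp
        rw [pow_add]
        field_simp
      rw [intervalIntegral.integral_eq_sub_of_hasDerivAt hd]
      · ring
      · refine ContinuousOn.intervalIntegrable fun y hy => ?_
        have hy0 : y ≠ 0 := fun h => hnot (h ▸ hy)
        exact ((continuousAt_inv₀ hy0).pow _).continuousWithinAt
    calc ‖∫ y in x..b, f p y‖ ≤ ∫ y in x..b, C * y⁻¹ ^ (m + 2) := by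
          refine intervalIntegral.norm_integral_le_of_norm_le hx.2
            (Filter.Eventually.of_forall fun y hy => hC p y ⟨hx0.trans hy.1, hy.2⟩) ?_
          refine ContinuousOn.intervalIntegrable fun y hy => ?_
          have hy0 : y ≠ 0 := fun h => hnot (h ▸ hy)
          exact (((continuousAt_inv₀ hy0).pow _).const_mul C).continuousWithinAt
      _ = C * ((x⁻¹ ^ (m + 1) - b⁻¹ ^ (m + 1)) / (m + 1)) := hint
      _ ≤ C * (x⁻¹ ^ (m + 1) / (m + 1)) := by
          have : 0 < b := hx0.trans_le hx.2
          gcongr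
          linarith [show 0 ≤ b⁻¹ ^ (m + 1) by positivity]
      _ = C / (m + 1) * x⁻¹ ^ (m + 1) := by ring
  · exact hf.neg

end SymbolClass

end Symbols

/-! ### Uniform derivative bounds on `𝒦` -/

/-- The `p_k`-balls about `0` are open, increasing and cover `𝒦`, so one of them contains `𝒦`. -/
lemma SmoothOnIcc.exists_iteratedDerivWithin_bound {b : ℝ} (hb : 0 < b)
    {𝒦 : Set (SmoothOnIcc b)} (h𝒦 : IsCompact 𝒦) (k : ℕ) :
    ∃ C : ℝ, ∀ W ∈ 𝒦, ∀ x ∈ Icc 0 b, ‖iteratedDerivWithin k W (Icc 0 b) x‖ ≤ C := by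
  let Z : SmoothOnIcc b := ⟨fun _ => 0, contDiffOn_const, fun _ _ => rfl⟩
  let U : ℕ → Set (SmoothOnIcc b) := fun n =>
    {g | smoothNorm b k (fun x => g x - Z x) < (n : ℝ) + 1}
  have hUopen : ∀ n, IsOpen (U n) := fun n =>
    TopologicalSpace.isOpen_generateFrom_of_mem ⟨Z, k, (n : ℝ) + 1, by positivity, rfl⟩
  have hUmono : Monotone U := fun m n hmn g (hg : _ < (m : ℝ) + 1) =>
    show _ < (n : ℝ) + 1 from hg.trans_le (by gcongr)
  have hcover : 𝒦 ⊆ ⋃ n, U n := fun g _ => by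
    obtain ⟨n, hn⟩ := exists_nat_gt (smoothNorm b k (fun x => g x - Z x))
    exact mem_iUnion.2 ⟨n, show _ < (n : ℝ) + 1 by linarith⟩
  obtain ⟨n, hn⟩ := h𝒦.elim_directed_cover U hUopen hcover hUmono.directed_le
  refine ⟨(n : ℝ) + 1, fun W hW x hx => ?_⟩
  have hlt : smoothNorm b k (fun x => W x - Z x) < (n : ℝ) + 1 := hn hW
  have hWZ : (fun x => W x - Z x) = W := by funext x; simp [Z]
  rw [hWZ] at hlt
  refine le_trans ?_ hlt.le
  refine le_csSup ?_ ⟨k, le_rfl, x, hx, rfl⟩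
  -- The real supremum defaults to `0` on unbounded sets, so boundedness has to be checked before
  -- `smoothNorm` dominates anything.
  have hcont : ∀ j : ℕ, ∃ C, ∀ x ∈ Icc 0 b, ‖iteratedDerivWithin j W (Icc 0 b) x‖ ≤ C := fun j =>
    isCompact_Icc.exists_bound_of_continuousOn
      (W.contDiffOn_toFun.continuousOn_iteratedDerivWithin
        (by exact_mod_cast (ENat.natCast_lt_top j).le) (uniqueDiffOn_Icc hb))
  choose C hC using hcont
  refine ⟨∑ j ∈ Finset.range (k + 1), |C j|, ?_⟩
  rintro r ⟨j, hj, x, hx, rfl⟩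
  calc |iteratedDerivWithin j W (Icc 0 b) x| ≤ |C j| := (hC j x hx).trans (le_abs_self _)
    _ ≤ ∑ j ∈ Finset.range (k + 1), |C j| :=
      Finset.single_le_sum (f := fun j => |C j|) (fun _ _ => abs_nonneg _)
        (Finset.mem_range.2 (by omega))

/-! ### Size of the WKB amplitudes -/

section Amplitudes

variable {P : Type*} {b : ℝ}

lemma SymbolClass.iteratedDerivWithin_two {n m : ℕ} {f : P → ℝ → ℂ}
    (hf : SymbolClass b (n + 2) m f) :
    SymbolClass b n (m + 2) (fun p => iteratedDerivWithin 2 (f p) (Ioc 0 b)) := by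
  refine hf.derivWithin.derivWithin.congr fun p x _ => ?_
  rw [iteratedDerivWithin_succ, iteratedDerivWithin_one]

lemma SymbolClass.hasDerivWithinAt_derivWithin {n m : ℕ} {f : P → ℝ → ℂ}
    (hf : SymbolClass b (n + 2) m f) (p : P) {x : ℝ} (hx : x ∈ Ioc 0 b) :
    HasDerivWithinAt (_root_.derivWithin (f p) (Ioc 0 b))
      (iteratedDerivWithin 2 (f p) (Ioc 0 b) x) (Ioc 0 b) x := by
  rw [iteratedDerivWithin_succ, iteratedDerivWithin_one]
  exact hf.derivWithin.hasDerivWithinAt p hx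

/-- Each step of the recursion raises the order by two through `A_k''` and lowers it by one through
the integral; the factors `A_0` have order `0`. -/
lemma SymbolClass.wkbAmplitude {q : P → ℝ → ℝ} {δ M : ℝ} (hδ : 0 < δ)
    (hq : ∀ p, ∀ x ∈ Ioc 0 b, q p x ∈ Icc δ M) (hsymb : ∀ n, SymbolClass b n 0 q) (k n : ℕ) :
    SymbolClass b n k (fun p => wkbAmplitude b (q p) k) := by
  have h0 : ∀ n, SymbolClass b n 0 (fun p x => ((q p x ^ (-(1 / 4) : ℝ) : ℝ) : ℂ)) := fun n =>
    (SymbolClass.rpow_const hδ hq (hsymb n) _).ofReal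
  induction k generalizing n with
  | zero => exact h0 n
  | succ k ih =>
    have h1 := ((ih (n + 2)).iteratedDerivWithin_two.mul (h0 n)).integral (m := k)
    have h2 := (SymbolClass.const (P := P) b n (c := fun _ => -(Complex.I / 2))
      (C := ‖-(Complex.I / 2)‖) fun _ => le_rfl).mul (h0 n)
    have h3 := h2.mul h1.of_succ
    rw [zero_add, zero_add] at h3
    exact h3

end Amplitudes

/-! ### Transport equations and the equation solved by the quasimode -/

section Quasimode

variable {b : ℝ} {q q' : ℝ → ℝ} {x : ℝ}

lemma rpow_neg_quarter_mul_sqrt {t : ℝ} (ht : 0 < t) :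
    t ^ (-(1 / 4) : ℝ) * t ^ (-(1 / 4) : ℝ) * √t = 1 := by
  rw [Real.sqrt_eq_rpow, ← Real.rpow_add ht, ← Real.rpow_add ht]
  norm_num

lemma hasDerivWithinAt_wkbAmplitude_zero (hpos : 0 < q x)
    (hq' : HasDerivWithinAt q (q' x) (Ioc 0 b) x) :
    HasDerivWithinAt (fun x => ((q x ^ (-(1 / 4) : ℝ) : ℝ) : ℂ))
      (-(q' x : ℂ) / 4 * ((q x ^ (-(1 / 4) : ℝ) : ℝ) : ℂ) / (√(q x) : ℂ) ^ 2) (Ioc 0 b) x := by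
  refine (hq'.rpow_const (p := (-(1 / 4) : ℝ)) (Or.inl hpos.ne')).ofReal_comp.congr_deriv ?_
  rw [Real.rpow_sub_one hpos.ne', ← Complex.ofReal_pow, Real.sq_sqrt hpos.le]
  push_cast
  ring

lemma transport_wkbAmplitude_zero (hpos : ∀ x ∈ Ioc 0 b, 0 < q x)
    (hq' : ∀ x ∈ Ioc 0 b, HasDerivWithinAt q (q' x) (Ioc 0 b) x) (hx : x ∈ Ioc 0 b) :
    2 * (√(q x) : ℂ) * derivWithin (wkbAmplitude b q 0) (Ioc 0 b) x +
      (q' x : ℂ) / (2 * (√(q x) : ℂ)) * wkbAmplitude b q 0 x = 0 := by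
  have hd : derivWithin (wkbAmplitude b q 0) (Ioc 0 b) x = _ :=
    (hasDerivWithinAt_wkbAmplitude_zero (hpos x hx) (hq' x hx)).derivWithin
      (uniqueDiffOn_Ioc 0 b x hx)
  have hs : (√(q x) : ℂ) ≠ 0 := by
    exact_mod_cast (Real.sqrt_pos.2 (hpos x hx)).ne'
  rw [hd, wkbAmplitude]
  field_simp
  ring

/-- Variation of constants: `A_0` solves the homogeneous equation, and `A_0² √q = 1` turns the
derivative of the integral into the right-hand side. -/
lemma transport_wkbAmplitude_succ (hpos : ∀ x ∈ Ioc 0 b, 0 < q x)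
    (hq' : ∀ x ∈ Ioc 0 b, HasDerivWithinAt q (q' x) (Ioc 0 b) x) {k : ℕ}
    (hcont : ContinuousOn (iteratedDerivWithin 2 (wkbAmplitude b q k) (Ioc 0 b)) (Ioc 0 b))
    (hx : x ∈ Ioc 0 b) :
    2 * (√(q x) : ℂ) * derivWithin (wkbAmplitude b q (k + 1)) (Ioc 0 b) x +
      (q' x : ℂ) / (2 * (√(q x) : ℂ)) * wkbAmplitude b q (k + 1) x =
      Complex.I * iteratedDerivWithin 2 (wkbAmplitude b q k) (Ioc 0 b) x := by
  have h0 := fun x hx => hasDerivWithinAt_wkbAmplitude_zero (hpos x hx) (hq' x hx)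
  have hJ := SymbolClass.hasDerivWithinAt_integral
    (hcont.mul fun x hx => (h0 x hx).continuousWithinAt) hx
  have hd : derivWithin (wkbAmplitude b q (k + 1)) (Ioc 0 b) x = _ :=
    (((h0 x hx).const_mul (-(Complex.I / 2))).mul hJ).derivWithin (uniqueDiffOn_Ioc 0 b x hx)
  have hs : (√(q x) : ℂ) ≠ 0 := by
    exact_mod_cast (Real.sqrt_pos.2 (hpos x hx)).ne'
  have ha : ((q x ^ (-(1 / 4) : ℝ) : ℝ) : ℂ) * ((q x ^ (-(1 / 4) : ℝ) : ℝ) : ℂ) * (√(q x) : ℂ) = 1 := by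
    exact_mod_cast rpow_neg_quarter_mul_sqrt (hpos x hx)
  rw [hd, wkbAmplitude]
  have key : ∀ a s A J : ℂ, s ≠ 0 → a * a * s = 1 →
      2 * s * (-(Complex.I / 2) * (-(q' x : ℂ) / 4 * a / s ^ 2) * J +
        -(Complex.I / 2) * a * -(A * a)) + (q' x : ℂ) / (2 * s) * (-(Complex.I / 2) * a * J) =
      Complex.I * A := by
    intro a s A J hs ha
    rw [← mul_one (Complex.I * A), ← ha]
    field_simp
    ring
  exact key _ _ _ _ hs ha

/-- The derivative of the quasimode `wkbPlus b q h N` on `(0, b]`. -/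
noncomputable def wkbPlusDeriv (b : ℝ) (q : ℝ → ℝ) (h : ℝ) (N : ℕ) (x : ℝ) : ℂ :=
  Complex.exp (Complex.I / (h : ℂ) * (wkbPhase b q x : ℂ)) *
    (Complex.I / (h : ℂ) * (√(q x) : ℂ) *
        ∑ k ∈ Finset.range (N + 1), (h : ℂ) ^ k * wkbAmplitude b q k x +
      ∑ k ∈ Finset.range (N + 1), (h : ℂ) ^ k * derivWithin (wkbAmplitude b q k) (Ioc 0 b) x)

lemma hasDerivWithinAt_wkbPhase (hcont : ContinuousOn q (Ioc 0 b)) (hx : x ∈ Ioc 0 b) :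
    HasDerivWithinAt (wkbPhase b q) (√(q x)) (Ioc 0 b) x :=
  (SymbolClass.hasDerivWithinAt_integral hcont.sqrt hx).neg.congr_deriv (neg_neg _)

lemma hasDerivWithinAt_exp_wkbPhase (hcont : ContinuousOn q (Ioc 0 b)) (h : ℝ)
    (hx : x ∈ Ioc 0 b) :
    HasDerivWithinAt (fun x => Complex.exp (Complex.I / (h : ℂ) * (wkbPhase b q x : ℂ)))
      (Complex.exp (Complex.I / (h : ℂ) * (wkbPhase b q x : ℂ)) *
        (Complex.I / (h : ℂ) * (√(q x) : ℂ))) (Ioc 0 b) x :=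
  ((hasDerivWithinAt_wkbPhase hcont hx).ofReal_comp.const_mul _).cexp

lemma hasDerivWithinAt_wkbPlus (hcont : ContinuousOn q (Ioc 0 b)) (h : ℝ) (N : ℕ)
    (hA : ∀ k, DifferentiableOn ℝ (wkbAmplitude b q k) (Ioc 0 b)) (hx : x ∈ Ioc 0 b) :
    HasDerivWithinAt (wkbPlus b q h N) (wkbPlusDeriv b q h N x) (Ioc 0 b) x := by
  have hsum := HasDerivWithinAt.fun_sum (u := Finset.range (N + 1)) fun k _ =>
    ((hA k x hx).hasDerivWithinAt.const_mul ((h : ℂ) ^ k))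
  refine ((hasDerivWithinAt_exp_wkbPhase hcont h hx).mul hsum).congr_deriv ?_
  rw [wkbPlusDeriv]
  ring

/-- The `h^(-2)` terms form `-(q/h²) u`. The `h^(-1)` terms, by transport, cancel all `h^k A_k''`
with `k < N`; only `k = N` survives. -/
lemma hasDerivWithinAt_wkbPlusDeriv (hpos : ∀ x ∈ Ioc 0 b, 0 < q x)
    (hq' : ∀ x ∈ Ioc 0 b, HasDerivWithinAt q (q' x) (Ioc 0 b) x) {h : ℝ} (hh : h ≠ 0) (N : ℕ)
    (hA : ∀ k, ∀ x ∈ Ioc 0 b, HasDerivWithinAt (wkbAmplitude b q k)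
      (derivWithin (wkbAmplitude b q k) (Ioc 0 b) x) (Ioc 0 b) x)
    (hA' : ∀ k, ∀ x ∈ Ioc 0 b, HasDerivWithinAt (derivWithin (wkbAmplitude b q k) (Ioc 0 b))
      (iteratedDerivWithin 2 (wkbAmplitude b q k) (Ioc 0 b) x) (Ioc 0 b) x)
    (hA'' : ∀ k, ContinuousOn (iteratedDerivWithin 2 (wkbAmplitude b q k) (Ioc 0 b)) (Ioc 0 b))
    (hx : x ∈ Ioc 0 b) :
    HasDerivWithinAt (wkbPlusDeriv b q h N)
      (-((q x / h ^ 2 : ℝ) : ℂ) * wkbPlus b q h N x +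
        Complex.exp (Complex.I / (h : ℂ) * (wkbPhase b q x : ℂ)) * (h : ℂ) ^ N *
          iteratedDerivWithin 2 (wkbAmplitude b q N) (Ioc 0 b) x) (Ioc 0 b) x := by
  have hcont : ContinuousOn q (Ioc 0 b) := fun x hx => (hq' x hx).continuousWithinAt
  have he := hasDerivWithinAt_exp_wkbPhase hcont h hx
  have hsum := HasDerivWithinAt.fun_sum (u := Finset.range (N + 1)) fun k _ =>
    ((hA k x hx).const_mul ((h : ℂ) ^ k))
  have hsum' := HasDerivWithinAt.fun_sum (u := Finset.range (N + 1)) fun k _ =>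
    ((hA' k x hx).const_mul ((h : ℂ) ^ k))
  have hs := (((hq' x hx).sqrt (hpos x hx).ne').ofReal_comp.const_mul (Complex.I / (h : ℂ)))
  refine (he.mul ((hs.mul hsum).add hsum')).congr_deriv ?_
  -- The transport equations summed with weights `h^k`; the shift `k + 1 ↦ k` explains the factor
  -- `h` and the shorter range on the right.
  have htransport : ∀ N : ℕ,
      2 * (√(q x) : ℂ) * ∑ k ∈ Finset.range (N + 1),
          (h : ℂ) ^ k * derivWithin (wkbAmplitude b q k) (Ioc 0 b) x +
        (q' x : ℂ) / (2 * (√(q x) : ℂ)) * ∑ k ∈ Finset.range (N + 1),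
          (h : ℂ) ^ k * wkbAmplitude b q k x =
      Complex.I * h * ∑ k ∈ Finset.range N,
          (h : ℂ) ^ k * iteratedDerivWithin 2 (wkbAmplitude b q k) (Ioc 0 b) x := by
    intro N
    induction N with
    | zero => simpa using transport_wkbAmplitude_zero hpos hq' hx
    | succ N ih =>
      have := transport_wkbAmplitude_succ hpos hq' (hA'' N) hx
      rw [Finset.sum_range_succ _ (N + 1), Finset.sum_range_succ _ (N + 1),
        Finset.sum_range_succ
          (fun k => (h : ℂ) ^ k * iteratedDerivWithin 2 (wkbAmplitude b q k) (Ioc 0 b) x) N,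
        mul_add (Complex.I * h), ← ih]
      linear_combination (h : ℂ) ^ (N + 1) * this
  have ht := htransport N
  have hh' : (h : ℂ) ≠ 0 := by exact_mod_cast hh
  have hsq : (√(q x) : ℂ) ^ 2 = q x := by exact_mod_cast Real.sq_sqrt (hpos x hx).le
  rw [wkbPlus, Finset.sum_range_succ
    (fun k => (h : ℂ) ^ k * iteratedDerivWithin 2 (wkbAmplitude b q k) (Ioc 0 b) x) N]
  push_cast
  rw [← hsq]
  simp only [Pi.mul_apply, Pi.add_apply] at ht ⊢
  generalize (√(q x) : ℂ) = s at *
  generalize ∑ k ∈ Finset.range N,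
    (h : ℂ) ^ k * iteratedDerivWithin 2 (wkbAmplitude b q k) (Ioc 0 b) x = T at *
  generalize ∑ k ∈ Finset.range (N + 1), (h : ℂ) ^ k * wkbAmplitude b q k x = A₀ at *
  generalize ∑ k ∈ Finset.range (N + 1),
    (h : ℂ) ^ k * derivWithin (wkbAmplitude b q k) (Ioc 0 b) x = A₁ at *
  generalize Complex.exp (Complex.I / (h : ℂ) * (wkbPhase b q x : ℂ)) = e at *
  have h1 : Complex.I / h * (Complex.I * h) = -1 := by
    field_simp
    exact Complex.I_sq
  have h2 : (Complex.I / h) ^ 2 = -(1 / (h : ℂ) ^ 2) := by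
    rw [div_pow, Complex.I_sq]; ring
  linear_combination e * (Complex.I / h) * ht + e * T * h1 + e * s ^ 2 * A₀ * h2

end Quasimode

/-! ### Energy estimate, exact solutions and independence -/

section Energy

variable {b : ℝ}

/-- Backward energy estimate for `w'' = -(q / h²) w - r` with `q` decreasing. -/
lemma energy_le {x₀ h δ F : ℝ} (hx₀ : 0 < x₀) (hh : h ≠ 0) (hδ : 0 < δ) {q q' : ℝ → ℝ}
    {w w' r : ℝ → ℂ} (hq : ∀ x ∈ Icc x₀ b, δ ≤ q x)
    (hq' : ∀ x ∈ Icc x₀ b, HasDerivWithinAt q (q' x) (Icc x₀ b) x)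
    (hq'_nonpos : ∀ x ∈ Icc x₀ b, q' x ≤ 0)
    (hw : ∀ x ∈ Icc x₀ b, HasDerivWithinAt w (w' x) (Icc x₀ b) x)
    (hw' : ∀ x ∈ Icc x₀ b,
      HasDerivWithinAt w' (-((q x / h ^ 2 : ℝ) : ℂ) * w x - r x) (Icc x₀ b) x)
    (hr : ∀ x ∈ Icc x₀ b, ‖r x‖ ≤ F) :
    ∀ x ∈ Icc x₀ b, ‖w x‖ ^ 2 + h ^ 2 * ‖w' x‖ ^ 2 / q x ≤
      Real.exp b * (‖w b‖ ^ 2 + h ^ 2 * ‖w' b‖ ^ 2 / q b + h ^ 2 * F ^ 2 / δ * b) := by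
  intro x hx
  set c : ℝ := h ^ 2 * F ^ 2 / δ with hc
  set G : ℝ → ℝ := fun x => ‖w x‖ ^ 2 + h ^ 2 * ‖w' x‖ ^ 2 / q x with hG
  set G' : ℝ → ℝ := fun x => -(2 * h ^ 2 * inner ℝ (w' x) (r x)) / q x -
    h ^ 2 * ‖w' x‖ ^ 2 * q' x / q x ^ 2 with hG'
  have hqpos : ∀ x ∈ Icc x₀ b, 0 < q x := fun x hx => hδ.trans_le (hq x hx)
  -- The weight `1/q` makes the cross terms in `⟨w, w'⟩` cancel.
  have hGd : ∀ x ∈ Icc x₀ b, HasDerivWithinAt G (G' x) (Icc x₀ b) x := by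
    intro x hx
    have hq0 := (hqpos x hx).ne'
    refine ((hw x hx).norm_sq.add (((hw' x hx).norm_sq.const_mul (h ^ 2)).div (hq' x hx)
      hq0)).congr_deriv ?_
    rw [inner_sub_right, neg_mul, inner_neg_right, ← Complex.real_smul, real_inner_smul_right,
      real_inner_comm (w x) (w' x)]
    simp only [hG']
    field_simp
    ring
  have hineq : ∀ x ∈ Icc x₀ b, 0 ≤ G x + G' x + c := by
    intro x hx
    have hq0 := hqpos x hx
    have hin : inner ℝ (w' x) (r x) ≤ ‖w' x‖ * F :=
      (real_inner_le_norm _ _).trans (mul_le_mul_of_nonneg_left (hr x hx) (norm_nonneg _))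
    -- The only term containing `q'` has a good sign, however large `q'` is.
    have h1 : 0 ≤ h ^ 2 * ‖w' x‖ ^ 2 * (-q' x) / q x ^ 2 := by
      have := neg_nonneg.2 (hq'_nonpos x hx)
      positivity
    have h2 : h ^ 2 * F ^ 2 / q x ≤ c := by
      rw [hc]
      have := hq x hx
      gcongr
    -- Completing the square absorbs the forcing term into `G + c`.
    have h3 : 0 ≤ h ^ 2 * (‖w' x‖ - F) ^ 2 / q x := by positivity
    have h4 : 2 * h ^ 2 * inner ℝ (w' x) (r x) / q x ≤ 2 * h ^ 2 * (‖w' x‖ * F) / q x := by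
      gcongr
    have h5 : h ^ 2 * (‖w' x‖ - F) ^ 2 / q x = h ^ 2 * ‖w' x‖ ^ 2 / q x -
        2 * h ^ 2 * (‖w' x‖ * F) / q x + h ^ 2 * F ^ 2 / q x := by ring
    have h6 : G x + G' x = ‖w x‖ ^ 2 + h ^ 2 * ‖w' x‖ ^ 2 / q x -
        2 * h ^ 2 * inner ℝ (w' x) (r x) / q x + h ^ 2 * ‖w' x‖ ^ 2 * (-q' x) / q x ^ 2 := by
      simp only [hG, hG']; ring
    have h7 : 0 ≤ ‖w x‖ ^ 2 := by positivity
    linarith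
  have hc0 : 0 ≤ c := by positivity
  -- Gronwall with integrating factor `e^x`; replacing `c e^x` by the larger `c e^b` keeps the
  -- correction linear in `x`.
  have hmono : MonotoneOn (fun x => Real.exp x * G x + c * Real.exp b * x) (Icc x₀ b) := by
    have hd : ∀ x ∈ Icc x₀ b, HasDerivWithinAt (fun x => Real.exp x * G x + c * Real.exp b * x)
        (Real.exp x * G x + Real.exp x * G' x + c * Real.exp b) (Icc x₀ b) x := by
      intro x hx
      refine (((Real.hasDerivAt_exp x).hasDerivWithinAt.mul (hGd x hx)).add
        ((hasDerivWithinAt_id x _).const_mul (c * Real.exp b))).congr_deriv (by simp)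
    refine monotoneOn_of_hasDerivWithinAt_nonneg (convex_Icc _ _)
      (fun x hx => (hd x hx).continuousWithinAt)
      (fun x hx => (hd x (interior_subset hx)).mono interior_subset) fun x hx => ?_
    have hx' := interior_subset hx
    have h1 : Real.exp x ≤ Real.exp b := Real.exp_le_exp.2 hx'.2
    have h2 := mul_nonneg (Real.exp_pos x).le (hineq x hx')
    nlinarith [mul_le_mul_of_nonneg_left h1 hc0]
  have hle := hmono hx ⟨hx.1.trans hx.2, le_rfl⟩ hx.2
  simp only at hle
  have hx0 : 0 ≤ x := hx₀.le.trans hx.1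
  have hG0 : 0 ≤ G x := by
    have := hqpos x hx
    simp only [hG]; positivity
  have h1 : G x ≤ Real.exp x * G x := le_mul_of_one_le_left hG0 (Real.one_le_exp hx0)
  have h2 : 0 ≤ c * Real.exp b * x := by positivity
  calc G x ≤ Real.exp b * G b + c * Real.exp b * b := by linarith
    _ = Real.exp b * (‖w b‖ ^ 2 + h ^ 2 * ‖w' b‖ ^ 2 / q b + c * b) := by simp only [hG]; ring

lemma isSchrodingerSolution_of_hasDerivWithinAt (hb : 0 < b) {h E : ℝ} (hh : h ≠ 0)
    {V : ℝ → ℝ} (hV : ContinuousOn V (Icc 0 b)) {y z : ℝ → ℂ}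
    (hy : ∀ x ∈ Icc 0 b, HasDerivWithinAt y (z x) (Icc 0 b) x)
    (hz : ∀ x ∈ Icc 0 b,
      HasDerivWithinAt z (-(((E - V x) / h ^ 2 : ℝ) : ℂ) * y x) (Icc 0 b) x) :
    IsSchrodingerSolution b h V E y := by
  have hu := uniqueDiffOn_Icc hb
  have h1 : EqOn (derivWithin y (Icc 0 b)) z (Icc 0 b) := fun x hx =>
    (hy x hx).derivWithin (hu x hx)
  have h2 : EqOn (derivWithin z (Icc 0 b)) (fun x => -(((E - V x) / h ^ 2 : ℝ) : ℂ) * y x)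
      (Icc 0 b) := fun x hx => (hz x hx).derivWithin (hu x hx)
  have hyc : ContinuousOn y (Icc 0 b) := fun x hx => (hy x hx).continuousWithinAt
  constructor
  · rw [← one_add_one_eq_two, contDiffOn_succ_iff_derivWithin hu]
    refine ⟨fun x hx => (hy x hx).differentiableWithinAt, by simp, ?_⟩
    refine ContDiffOn.congr ?_ h1
    rw [← zero_add (1 : WithTop ℕ∞), contDiffOn_succ_iff_derivWithin hu]
    refine ⟨fun x hx => (hz x hx).differentiableWithinAt, by simp, ?_⟩
    refine ContDiffOn.congr ?_ h2
    rw [contDiffOn_zero]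
    exact (Complex.continuous_ofReal.comp_continuousOn
      ((continuousOn_const.sub hV).div_const _)).neg.mul hyc
  · intro x hx
    have hh' : (h : ℂ) ≠ 0 := by exact_mod_cast hh
    rw [iteratedDerivWithin_succ, iteratedDerivWithin_one, derivWithin_congr h1 (h1 hx), h2 hx]
    push_cast
    field_simp
    ring

/-- The Wronskian of `y` and its conjugate at `b` is, up to sign, `2i` times the imaginary part
assumed nonzero. -/
lemma linearIndependent_conj {y : ℝ → ℂ} {d : ℂ} (hb : 0 < b)
    (hy : HasDerivWithinAt y d (Icc 0 b) b) (hd : (d * starRingEnd ℂ (y b)).im ≠ 0) :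
    LinearIndependent ℂ
      ![(Icc 0 b).domRestrict y, (Icc 0 b).domRestrict fun x => starRingEnd ℂ (y x)] := by
  rw [LinearIndependent.pair_iff]
  intro s t hst
  have hbm : b ∈ Icc 0 b := ⟨hb.le, le_rfl⟩
  have h1 : ∀ x ∈ Icc 0 b, s * y x + t * starRingEnd ℂ (y x) = 0 := fun x hx =>
    congrFun hst ⟨x, hx⟩
  have h2 : s * d + t * starRingEnd ℂ d = 0 := by
    have hz : HasDerivWithinAt (fun _ : ℝ => (0 : ℂ)) 0 (Icc 0 b) b := hasDerivWithinAt_const _ _ _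
    exact (uniqueDiffOn_Icc hb b hbm).eq_deriv _
      ((hy.const_mul s).add (hy.star.const_mul t)) (hz.congr h1 (h1 b hbm))
  have h3 := h1 b hbm
  have hne : d * starRingEnd ℂ (y b) - starRingEnd ℂ d * y b ≠ 0 := by
    intro h
    have := congrArg Complex.im h
    apply hd
    simp at this ⊢
    linarith
  constructor
  · refine (mul_eq_zero.1 ?_).resolve_right hne
    linear_combination starRingEnd ℂ (y b) * h2 - starRingEnd ℂ d * h3
  · refine (mul_eq_zero.1 ?_).resolve_right hne
    linear_combination d * h3 - y b * h2

lemma semiclassicalC1Norm_le {a h B : ℝ} (ha : 0 < a) {v v' : ℝ → ℂ}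
    (hv : ∀ x ∈ Icc a b, HasDerivWithinAt v (v' x) (Ioc 0 b) x)
    (hB : ∀ x ∈ Icc a b, ‖v x‖ ≤ B ∧ ‖(h : ℂ) * v' x‖ ≤ B) :
    semiclassicalC1Norm a b h v ≤ ENNReal.ofReal B := by
  refine iSup₂_le fun x hx => ?_
  rw [(hv x hx).derivWithin (uniqueDiffOn_Ioc 0 b x ⟨ha.trans_le hx.1, hx.2⟩), ← ofReal_norm,
    ← ofReal_norm]
  exact max_le (ENNReal.ofReal_le_ofReal (hB x hx).1) (ENNReal.ofReal_le_ofReal (hB x hx).2)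

/-- The phase and all `A_{k+1}` vanish at `b`. The value is therefore real, as
`exists_small_im_ne_zero` requires. -/
lemma wkbPlus_right_endpoint (b : ℝ) (q : ℝ → ℝ) (h : ℝ) (N : ℕ) :
    wkbPlus b q h N b = ((q b ^ (-(1 / 4) : ℝ) : ℝ) : ℂ) := by
  rw [wkbPlus, Finset.sum_range_succ']
  simp [wkbPhase, wkbAmplitude]

lemma norm_exp_wkbPhase (b : ℝ) (q : ℝ → ℝ) (h x : ℝ) :
    ‖Complex.exp (Complex.I / (h : ℂ) * (wkbPhase b q x : ℂ))‖ = 1 := by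
  rw [show Complex.I / (h : ℂ) * (wkbPhase b q x : ℂ) =
    ((wkbPhase b q x / h : ℝ) : ℂ) * Complex.I by push_cast; ring]
  exact Complex.norm_exp_ofReal_mul_I _

end Energy

/-! ### Choice of parameters and proof of the theorem -/

lemma exists_small_im_ne_zero {c : ℝ} (hc : 0 < c) (d : ℂ) {t : ℝ} (ht : 0 < t) :
    ∃ η : ℝ, 0 ≤ η ∧ η ≤ t ∧ ((d + Complex.I * η) * starRingEnd ℂ (c : ℂ)).im ≠ 0 := by
  by_cases hd : d.im = 0
  · exact ⟨t, ht.le, le_rfl, by simp [hd, hc.ne', ht.ne']⟩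
  · exact ⟨0, le_rfl, ht.le, by simp [hd, hc.ne']⟩

/-- At `x = h^(1-ε)`, the worst point, the exponent is `N - (1-ε)(N+2) = ε(N+2) - 2`. -/
lemma mul_rpow_inv_pow_le {h ε D : ℝ} (hh : h ∈ Ioc (0 : ℝ) 1) {N : ℕ}
    (hN : D + 1 ≤ ε * (N + 2)) {x : ℝ} (hx : h ^ (1 - ε) ≤ x) :
    h ^ N * x⁻¹ ^ (N + 2) ≤ h ^ (D - 1) := by
  have h0 := hh.1
  have hpos : 0 < h ^ (1 - ε) := Real.rpow_pos_of_pos h0 _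
  calc h ^ N * x⁻¹ ^ (N + 2) ≤ h ^ N * (h ^ (1 - ε))⁻¹ ^ (N + 2) := by
        have := hpos.trans_le hx
        gcongr
    _ = h ^ (ε * (N + 2) - 2) := by
        rw [← Real.rpow_neg h0.le, ← Real.rpow_natCast, ← Real.rpow_natCast, ← Real.rpow_mul h0.le,
          ← Real.rpow_add h0]
        congr 1
        push_cast
        ring
    _ ≤ h ^ (D - 1) := Real.rpow_le_rpow_of_exponent_ge h0 hh.2 (by linarith)

theorem mainTheorem2 (b : ℝ) (hb : 0 < b) (γ : ℝ) (hγ : 0 < γ)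
    (𝒦 : Set (SmoothOnIcc b)) (h𝒦 : IsCompact 𝒦)
    (Emin Emax : ℝ) (hEmin : 0 < Emin) (hE : Emin ≤ Emax)
    (hallowed : ∃ δ : ℝ, 0 < δ ∧ ∀ W ∈ 𝒦, AdmissiblePotential γ b W →
      ∀ E ∈ Icc Emin Emax, ∀ x ∈ Icc 0 b, δ ≤ E - potential γ W x)
    (ε : ℝ) (hε : ε ∈ Ioo (0 : ℝ) 1) (D : ℝ) :
    ∃ (N : ℕ) (C : ℝ), 0 < C ∧
      ∀ W ∈ 𝒦, AdmissiblePotential γ b W → ∀ E ∈ Icc Emin Emax, ∀ h ∈ Ioc (0 : ℝ) 1,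
        ∃ ψp ψm : ℝ → ℂ,
          IsSchrodingerSolution b h (potential γ W) E ψp ∧
          IsSchrodingerSolution b h (potential γ W) E ψm ∧
          LinearIndependent ℂ ![(Icc 0 b).domRestrict ψp, (Icc 0 b).domRestrict ψm] ∧
          semiclassicalC1Norm (h ^ (1 - ε)) b h
            (fun x => ψp x - wkbPlus b (fun y => E - potential γ W y) h N x)
              ≤ ENNReal.ofReal (C * h ^ D) ∧
          semiclassicalC1Norm (h ^ (1 - ε)) b h
            (fun x => ψm x - wkbMinus b (fun y => E - potential γ W y) h N x)
              ≤ ENNReal.ofReal (C * h ^ D) := by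
  obtain ⟨δ, hδ, hδq⟩ := hallowed
  -- With the pairs `(W, E)` as parameters, every symbol constant is uniform in them; `h` is left
  -- out because the amplitudes do not depend on it.
  let P := {p : SmoothOnIcc b × ℝ // p.1 ∈ 𝒦 ∧ AdmissiblePotential γ b p.1 ∧ p.2 ∈ Icc Emin Emax}
  let q : P → ℝ → ℝ := fun p x => p.1.2 - potential γ p.1.1 x
  have hqmem : ∀ p, ∀ x ∈ Ioc 0 b, q p x ∈ Icc δ Emax := by
    intro p x hx
    refine ⟨hδq _ p.2.1 p.2.2.1 _ p.2.2.2 x (Ioc_subset_Icc_self hx), ?_⟩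
    have h1 := p.2.2.2.2
    have h2 : 0 ≤ potential γ p.1.1 x :=
      mul_nonneg (Real.rpow_nonneg hx.1.le _) (p.2.2.1.1 x (Ioc_subset_Icc_self hx)).le
    simp only [q]
    linarith
  have hsymb : ∀ n, SymbolClass b n 0 q := by
    intro n
    have hW : SymbolClass b n 0 (fun p : P => (p.1.1 : ℝ → ℝ)) := by
      refine SymbolClass.of_iteratedDerivWithin_bound hb (fun p => p.1.1.contDiffOn_toFun)
        (fun k => ?_) n
      obtain ⟨C, hC⟩ := SmoothOnIcc.exists_iteratedDerivWithin_bound hb h𝒦 k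
      exact ⟨C, fun p => hC _ p.2.1⟩
    have hc : SymbolClass b n 0 (fun (p : P) (_ : ℝ) => p.1.2) := by
      refine SymbolClass.const b n (C := Emax) fun p => ?_
      rw [Real.norm_of_nonneg (hEmin.le.trans p.2.2.2.1)]
      exact p.2.2.2.2
    have hx : SymbolClass b n 0 (fun (_ : P) (x : ℝ) => x ^ γ) :=
      SymbolClass.id_rpow b n 0 (by simpa using hγ.le)
    have h1 := hc.add (hx.mul hW).neg
    refine h1.congr fun p x _ => ?_
    simp only [q, potential, sub_eq_add_neg]
  have hA := SymbolClass.wkbAmplitude hδ hqmem hsymb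
  obtain ⟨N, hN⟩ : ∃ N : ℕ, D + 1 ≤ ε * (N + 2) := by
    obtain ⟨N, hN⟩ := exists_nat_gt ((D + 1) / ε)
    refine ⟨N, ?_⟩
    rw [div_lt_iff₀ hε.1] at hN
    nlinarith [hε.1]
  obtain ⟨C₀, hC₀⟩ := (hA N 2).iteratedDerivWithin_two.exists_bound
  have hEmax : 0 < Emax := hEmin.trans_le hE
  -- The energy bound divided by `h^(2D)`: `1/δ` comes from the perturbed derivative at `b`, `C₀²
  -- b/δ` from the WKB remainder.
  set B : ℝ := Real.exp b * (1 / δ + C₀ ^ 2 / δ * b) with hBdef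
  have hB : 0 < B := by positivity
  -- Since `q ≤ Emax`, the factor `1 + Emax` covers both `|w|²` and `h²|w'|²`.
  refine ⟨N, √(B * (1 + Emax)), by positivity, fun W hW hadm E hEmem h hh => ?_⟩
  let p : P := ⟨(W, E), hW, hadm, hEmem⟩
  have h0 : 0 < h := hh.1
  have hbm : b ∈ Ioc 0 b := ⟨hb, le_rfl⟩
  change ∃ ψp ψm : ℝ → ℂ, _ ∧ _ ∧ _ ∧
    semiclassicalC1Norm (h ^ (1 - ε)) b h (fun x => ψp x - wkbPlus b (q p) h N x) ≤ _ ∧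
    semiclassicalC1Norm (h ^ (1 - ε)) b h (fun x => ψm x - wkbMinus b (q p) h N x) ≤ _
  have hVc : ContinuousOn (potential γ W) (Icc 0 b) :=
    (Real.continuous_rpow_const hγ.le).continuousOn.mul W.contDiffOn_toFun.continuousOn
  have hQc : ContinuousOn (fun x => (E - potential γ W x) / h ^ 2) (Icc 0 b) :=
    (continuousOn_const.sub hVc).div_const _
  have hq' : ∀ x ∈ Ioc 0 b,
      HasDerivWithinAt (q p) (derivWithin (q p) (Ioc 0 b) x) (Ioc 0 b) x := fun x hx =>
    (hsymb 1).hasDerivWithinAt p hx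
  have hqpos : ∀ x ∈ Ioc 0 b, 0 < q p x := fun x hx => hδ.trans_le (hqmem p x hx).1
  have hanti : AntitoneOn (q p) (Ioc 0 b) := fun x hx y hy hxy =>
    sub_le_sub_left (hadm.2 hx hy hxy) E
  have hu : ∀ x ∈ Ioc 0 b,
      HasDerivWithinAt (wkbPlus b (q p) h N) (wkbPlusDeriv b (q p) h N x) (Ioc 0 b) x :=
    fun x hx => hasDerivWithinAt_wkbPlus ((hsymb 0).continuousOn p) h N
      (fun k x hx => ((hA k 1).hasDerivWithinAt p hx).differentiableWithinAt) hx
  have hu' := fun x (hx : x ∈ Ioc 0 b) => hasDerivWithinAt_wkbPlusDeriv hqpos hq' h0.ne' N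
    (fun k x hx => (hA k 1).hasDerivWithinAt p hx)
    (fun k x hx => (hA k 2).hasDerivWithinAt_derivWithin p hx)
    (fun k => (hA k 2).iteratedDerivWithin_two.continuousOn p) hx
  -- The lower-order terms `h^k A_k'(b)` could make the Wronskian vanish; `η ≤ h^D` prevents this at
  -- an admissible cost.
  obtain ⟨η, hη0, hηle, hη⟩ := exists_small_im_ne_zero (c := q p b ^ (-(1 / 4) : ℝ))
    (Real.rpow_pos_of_pos (hqpos b hbm) _) (wkbPlusDeriv b (q p) h N b)
    (Real.rpow_pos_of_pos h0 D)
  rw [← wkbPlus_right_endpoint b (q p) h N] at hη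
  obtain ⟨y, z, hyb, hzb, hyz⟩ := exists_complex_solution_terminal hb.le hQc
    (wkbPlus b (q p) h N b) (wkbPlusDeriv b (q p) h N b + Complex.I * η)
  have hyz₀ : ∀ x ∈ Ioc 0 b, HasDerivWithinAt y (z x) (Ioc 0 b) x ∧
      HasDerivWithinAt z (-((q p x / h ^ 2 : ℝ) : ℂ) * y x) (Ioc 0 b) x := fun x hx =>
    ⟨(hyz x (Ioc_subset_Icc_self hx)).1.mono Ioc_subset_Icc_self,
      (hyz x (Ioc_subset_Icc_self hx)).2.mono Ioc_subset_Icc_self⟩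
  set x₀ := h ^ (1 - ε) with hx₀def
  have hx₀ : 0 < x₀ := Real.rpow_pos_of_pos h0 _
  have hsub : Icc x₀ b ⊆ Ioc 0 b := fun x hx => ⟨hx₀.trans_le hx.1, hx.2⟩
  set w : ℝ → ℂ := fun x => y x - wkbPlus b (q p) h N x with hwdef
  set w' : ℝ → ℂ := fun x => z x - wkbPlusDeriv b (q p) h N x with hw'def
  have hwd : ∀ x ∈ Ioc 0 b, HasDerivWithinAt w (w' x) (Ioc 0 b) x := fun x hx =>
    (hyz₀ x hx).1.sub (hu x hx)
  have hwd' : ∀ x ∈ Ioc 0 b, HasDerivWithinAt w' (-((q p x / h ^ 2 : ℝ) : ℂ) * w x -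
      Complex.exp (Complex.I / (h : ℂ) * (wkbPhase b (q p) x : ℂ)) * (h : ℂ) ^ N *
        iteratedDerivWithin 2 (wkbAmplitude b (q p) N) (Ioc 0 b) x) (Ioc 0 b) x := by
    intro x hx
    refine ((hyz₀ x hx).2.sub (hu' x hx)).congr_deriv ?_
    simp only [hwdef]
    ring
  have henergy : ∀ x ∈ Icc x₀ b, ‖w x‖ ^ 2 + h ^ 2 * ‖w' x‖ ^ 2 / q p x ≤ B * (h ^ D) ^ 2 := by
    intro x hx
    have hC₀0 : 0 ≤ C₀ :=
      nonneg_of_mul_nonneg_left ((norm_nonneg _).trans (hC₀ p b hbm)) (by positivity)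
    refine (energy_le (F := C₀ * h ^ (D - 1)) hx₀ h0.ne' hδ
      (fun x hx => (hqmem p x (hsub hx)).1) (fun x hx => (hq' x (hsub hx)).mono hsub)
      (fun x _ => hanti.derivWithin_nonpos) (fun x hx => (hwd x (hsub hx)).mono hsub)
      (fun x hx => (hwd' x (hsub hx)).mono hsub) (fun x hx => ?_) x hx).trans ?_
    · rw [norm_mul, norm_mul, norm_exp_wkbPhase, one_mul, norm_pow, Complex.norm_real,
        Real.norm_of_nonneg h0.le]
      calc h ^ N * ‖iteratedDerivWithin 2 (wkbAmplitude b (q p) N) (Ioc 0 b) x‖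
          ≤ h ^ N * (C₀ * x⁻¹ ^ (N + 2)) := by
            gcongr
            exact hC₀ p x (hsub hx)
        _ = C₀ * (h ^ N * x⁻¹ ^ (N + 2)) := by ring
        _ ≤ C₀ * h ^ (D - 1) := by
            gcongr
            exact mul_rpow_inv_pow_le hh hN hx.1
    · have hwb : w b = 0 := by simp [hwdef, hyb]
      have hwb' : ‖w' b‖ = η := by
        simp [hw'def, hzb, abs_of_nonneg hη0]
      have hhD : h ^ 2 * (C₀ * h ^ (D - 1)) ^ 2 = C₀ ^ 2 * (h ^ D) ^ 2 := by
        rw [Real.rpow_sub_one h0.ne']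
        field_simp
      have hbdry : h ^ 2 * η ^ 2 / q p b ≤ 1 ^ 2 * (h ^ D) ^ 2 / δ := by
        have h1 := hh.2
        have h2 := (hqmem p b hbm).1
        gcongr
      rw [hwb, hwb', hhD, hBdef, mul_assoc]
      gcongr
      calc ‖(0 : ℂ)‖ ^ 2 + h ^ 2 * η ^ 2 / q p b + C₀ ^ 2 * (h ^ D) ^ 2 / δ * b
          ≤ 0 + 1 ^ 2 * (h ^ D) ^ 2 / δ + C₀ ^ 2 * (h ^ D) ^ 2 / δ * b := by
            gcongr
            simp
        _ = (1 / δ + C₀ ^ 2 / δ * b) * (h ^ D) ^ 2 := by ring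
  have hbound : ∀ x ∈ Icc x₀ b, ‖w x‖ ≤ √(B * (1 + Emax)) * h ^ D ∧
      ‖(h : ℂ) * w' x‖ ≤ √(B * (1 + Emax)) * h ^ D := by
    intro x hx
    have hqx := hqmem p x (hsub hx)
    have hqx0 := hqpos x (hsub hx)
    have he := henergy x hx
    have hD : 0 < h ^ D := Real.rpow_pos_of_pos h0 D
    have hsq : (√(B * (1 + Emax)) * h ^ D) ^ 2 = B * (h ^ D) ^ 2 * (1 + Emax) := by
      rw [mul_pow, Real.sq_sqrt (by positivity)]; ring
    have hBD : 0 ≤ B * (h ^ D) ^ 2 := by positivity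
    have h1 : 0 ≤ h ^ 2 * ‖w' x‖ ^ 2 / q p x := by positivity
    have h2 : h ^ 2 * ‖w' x‖ ^ 2 / q p x ≤ B * (h ^ D) ^ 2 := by nlinarith [sq_nonneg ‖w x‖]
    constructor
    · refine (pow_le_pow_iff_left₀ (norm_nonneg _) (by positivity) two_ne_zero).1 ?_
      rw [hsq]
      nlinarith
    · refine (pow_le_pow_iff_left₀ (norm_nonneg _) (by positivity) two_ne_zero).1 ?_
      rw [hsq, norm_mul, Complex.norm_real, Real.norm_of_nonneg h0.le, mul_pow]
      rw [div_le_iff₀ hqx0] at h2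
      nlinarith [mul_le_mul_of_nonneg_left hqx.2 hBD]
  -- The coefficients of the equation are real, so the conjugate is again a solution, with conjugate
  -- error.
  refine ⟨y, fun x => starRingEnd ℂ (y x), ?_, ?_, ?_, ?_, ?_⟩
  · exact isSchrodingerSolution_of_hasDerivWithinAt hb h0.ne' hVc (fun x hx => (hyz x hx).1)
      (fun x hx => (hyz x hx).2)
  · refine isSchrodingerSolution_of_hasDerivWithinAt hb h0.ne' hVc
      (z := fun x => starRingEnd ℂ (z x)) (fun x hx => (hyz x hx).1.star)
      (fun x hx => (hyz x hx).2.star.congr_deriv ?_)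
    simp
  · have hyb' := (hyz b ⟨hb.le, le_rfl⟩).1
    refine linearIndependent_conj hb hyb' ?_
    rw [hzb, hyb]
    exact hη
  · exact semiclassicalC1Norm_le hx₀ (fun x hx => hwd x (hsub hx)) hbound
  · have hconj : (fun x => starRingEnd ℂ (y x) - wkbMinus b (q p) h N x) =
        fun x => starRingEnd ℂ (w x) := by
      funext x
      simp [hwdef, wkbMinus]
    rw [hconj]
    refine semiclassicalC1Norm_le hx₀ (v' := fun x => starRingEnd ℂ (w' x))
      (fun x hx => (hwd x (hsub hx)).star) fun x hx => ?_
    have := hbound x hx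
    rw [norm_mul] at this ⊢
    simpa only [RCLike.norm_conj] using this
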